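/- Let $\kappa$ be a cardinal, regarded as the set of ordinals below it, and let $\mathcal{A}_\kappa=\{a_{\alpha,n}^{\pm1} : \alpha<\kappa,\ n<\omega\}$ be a set of letters with formal inverses. A *word* is a function $W:\overline{W}\to\mathcal{A}_\kappa$ on a totally ordered set $\overline{W}$ such that for each $N\in\omega$ only finitely many $i\in\overline{W}$ are sent to a letter whose second subscript is $\le N$; let $p_N(W)$ be the finite word obtained by restricting $W$ to these $i$. Write $W_0\sim W_1$ if for every $N\in\omega$ the words $p_N(W_0)$ and $p_N(W_1)$ are equal in the free group on $\{a_{\alpha,n} : \alpha<\kappa,\ n<\omega\}$. The $\sim$-classes of words (order-isomorphic copies of a word being identified) form a group $\mathrm{H}_\kappa$ under concatenation. A word is *pure* if there is $\alpha<\kappa$ such that all of its letters have first subscript $\alpha$. The *cone group* $\mathcal{C}_\kappa$ is the quotient of $\mathrm{H}_\kappa$ by the smallest normal subgroup containing the classes of all pure words. **Theorem.** For each cardinal $\kappa$, $$|\mathcal{C}_\kappa|=\begin{cases}1 & \text{if } \kappa=0,\\ \kappa^{\aleph_0} & \text{if }\kappa\ge 1.\end{cases}$$ -/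

import Mathlib

universe u v

/-- Letters `a_{α,n}^{±1}` with `α : A` and `n : ℕ`.  The letter `((α, n), true)` is `a_{α,n}` and
`((α, n), false)` is `a_{α,n}⁻¹`; this is the convention of `FreeGroup.mk`. -/
abbrev Letter (A : Type u) : Type u := (A × ℕ) × Bool

namespace Letter

variable {A : Type u}

/-- The first subscript of a letter. -/
def proj₀ (x : Letter A) : A := x.1.1

/-- The second subscript of a letter. -/
def proj₁ (x : Letter A) : ℕ := x.1.2

/-- The formal inverse of a letter. -/
def inv (x : Letter A) : Letter A := (x.1, !x.2)

end Letter

/-- A word in the letters `a_{α,n}^{±1}`: a function from a totally ordered set to the letters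
such that for every `N` only finitely many positions carry a letter with second subscript `≤ N`.
Such a domain is countable, so nothing is lost (up to order isomorphism) by taking it in `Type`;
see `Word.exists_orderIso`. -/
structure Word (A : Type u) : Type (max u 1) where
  dom : Type
  [order : LinearOrder dom]
  letter : dom → Letter A
  finite_le : ∀ N : ℕ, {i | (letter i).proj₁ ≤ N}.Finite

attribute [instance] Word.order

namespace Word

variable {A : Type u}

/-- A word over a totally ordered set in an arbitrary universe is isomorphic to a `Word`. -/
theorem exists_orderIso {D : Type v} [LinearOrder D] (f : D → Letter A)
    (hf : ∀ N : ℕ, {i | (f i).proj₁ ≤ N}.Finite) :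
    ∃ (W : Word A) (e : D ≃o W.dom), ∀ i, W.letter (e i) = f i := by
  have hc : Countable D := by
    rw [← Set.countable_univ_iff]
    refine (Set.countable_iUnion fun N => (hf N).countable).mono fun i _ => ?_
    exact Set.mem_iUnion.2 ⟨(f i).proj₁, le_refl (f i).proj₁⟩
  have hs : Small.{0} D := inferInstance
  let e := (equivShrink.{0} D).symm
  let _ : LinearOrder (Shrink.{0} D) := LinearOrder.lift' e e.injective
  refine ⟨⟨Shrink.{0} D, fun i => f (e i), fun N => ?_⟩, ⟨e.symm, ?_⟩, fun i => ?_⟩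
  · exact (hf N).preimage e.injective.injOn
  · intro a b
    change e (e.symm a) ≤ e (e.symm b) ↔ a ≤ b
    simp
  · change f (e (e.symm i)) = f i
    simp

/-- `W₀ ≡ W₁`: there is an order isomorphism of the domains that preserves the letters. -/
def Equivalent (W₀ W₁ : Word A) : Prop :=
  ∃ e : W₀.dom ≃o W₁.dom, ∀ i, W₁.letter (e i) = W₀.letter i

/-- The empty word `E`. -/
def empty : Word A where
  dom := PEmpty
  letter := PEmpty.elim
  finite_le _ := Set.toFinite _

/-- The concatenation `W₀W₁`: all positions of `W₀` are placed below all those of `W₁`. -/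
def concat (W₀ W₁ : Word A) : Word A where
  dom := W₀.dom ⊕ₗ W₁.dom
  letter i := Sum.elim W₀.letter W₁.letter (ofLex i)
  finite_le N := by
    refine (((W₀.finite_le N).image (fun i => toLex (Sum.inl i))).union
      ((W₁.finite_le N).image (fun i => toLex (Sum.inr i)))).subset ?_
    intro i hi
    obtain ⟨i, rfl⟩ := toLex.surjective i
    cases i with
    | inl j => exact Or.inl ⟨j, hi, rfl⟩
    | inr j => exact Or.inr ⟨j, hi, rfl⟩

/-- The inverse word `W⁻¹`: the order is reversed and every letter is inverted. -/
def inv (W : Word A) : Word A where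
  dom := W.domᵒᵈ
  letter i := (W.letter (OrderDual.ofDual i)).inv
  finite_le N := (W.finite_le N).preimage OrderDual.ofDual.injective.injOn

/-- The finite word `p_N(W)`: the restriction of `W` to the positions whose letters have second
subscript `≤ N`, as the list of its letters in increasing order of position. -/
noncomputable def trunc (N : ℕ) (W : Word A) : List (Letter A) :=
  ((W.finite_le N).toFinset.sort (· ≤ ·)).map W.letter

/-- `p_N(W)` as an element of the free group on the positive letters. -/
noncomputable def eval (N : ℕ) (W : Word A) : FreeGroup (A × ℕ) :=
  FreeGroup.mk (trunc N W)

theorem trunc_eq (N : ℕ) (W : Word A) (l : List W.dom) (hl : l.SortedLT)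
    (hm : ∀ i, i ∈ l ↔ (W.letter i).proj₁ ≤ N) : trunc N W = l.map W.letter := by
  unfold trunc
  congr 1
  refine List.SortedLT.eq_of_mem_iff (Finset.sortedLT_sort _) hl fun i => ?_
  simp [hm]

theorem exists_trunc (N : ℕ) (W : Word A) : ∃ l : List W.dom, l.SortedLT ∧
    (∀ i, i ∈ l ↔ (W.letter i).proj₁ ≤ N) ∧ trunc N W = l.map W.letter :=
  ⟨_, Finset.sortedLT_sort _, by simp, rfl⟩

theorem trunc_empty (N : ℕ) : trunc N (empty : Word A) = [] :=
  trunc_eq N empty [] (by simp [List.sortedLT_iff_pairwise]) (fun i => i.elim)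

/-- The positions of `W₀` as positions of `W₀W₁`. -/
def inl (W₀ W₁ : Word A) (i : W₀.dom) : (concat W₀ W₁).dom := toLex (Sum.inl i)

/-- The positions of `W₁` as positions of `W₀W₁`. -/
def inr (W₀ W₁ : Word A) (i : W₁.dom) : (concat W₀ W₁).dom := toLex (Sum.inr i)

theorem concat_cases {W₀ W₁ : Word A} (i : (concat W₀ W₁).dom) :
    (∃ j, i = inl W₀ W₁ j) ∨ ∃ j, i = inr W₀ W₁ j := by
  rcases h : (ofLex i : W₀.dom ⊕ W₁.dom) with j | j
  · exact Or.inl ⟨j, congrArg toLex h⟩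
  · exact Or.inr ⟨j, congrArg toLex h⟩

theorem inl_lt_inl {W₀ W₁ : Word A} {i j : W₀.dom} : inl W₀ W₁ i < inl W₀ W₁ j ↔ i < j :=
  Sum.Lex.inl_lt_inl_iff

theorem inr_lt_inr {W₀ W₁ : Word A} {i j : W₁.dom} : inr W₀ W₁ i < inr W₀ W₁ j ↔ i < j :=
  Sum.Lex.inr_lt_inr_iff

theorem inl_lt_inr {W₀ W₁ : Word A} (i : W₀.dom) (j : W₁.dom) : inl W₀ W₁ i < inr W₀ W₁ j :=
  Sum.Lex.inl_lt_inr _ _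

theorem trunc_concat (N : ℕ) (W₀ W₁ : Word A) :
    trunc N (concat W₀ W₁) = trunc N W₀ ++ trunc N W₁ := by
  obtain ⟨l₀, s₀, m₀, e₀⟩ := exists_trunc N W₀
  obtain ⟨l₁, s₁, m₁, e₁⟩ := exists_trunc N W₁
  have h := trunc_eq N (concat W₀ W₁) (l₀.map (inl W₀ W₁) ++ l₁.map (inr W₀ W₁)) ?_ ?_
  · rw [h, e₀, e₁, List.map_append, List.map_map, List.map_map]
    rfl
  · rw [List.sortedLT_iff_pairwise] at s₀ s₁ ⊢
    rw [List.pairwise_append]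
    refine ⟨?_, ?_, ?_⟩
    · rw [List.pairwise_map]
      exact s₀.imp fun hab => inl_lt_inl.2 hab
    · rw [List.pairwise_map]
      exact s₁.imp fun hab => inr_lt_inr.2 hab
    · intro a ha b hb
      obtain ⟨a', -, rfl⟩ := List.mem_map.1 ha
      obtain ⟨b', -, rfl⟩ := List.mem_map.1 hb
      exact inl_lt_inr _ _
  · intro i
    rw [List.mem_append, List.mem_map, List.mem_map]
    constructor
    · rintro (⟨j, hj, rfl⟩ | ⟨j, hj, rfl⟩)
      · exact (m₀ j).1 hj
      · exact (m₁ j).1 hj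
    · rcases concat_cases i with ⟨j, rfl⟩ | ⟨j, rfl⟩
      · exact fun hj => Or.inl ⟨j, (m₀ j).2 hj, rfl⟩
      · exact fun hj => Or.inr ⟨j, (m₁ j).2 hj, rfl⟩

/-- The positions of `W` as positions of `W⁻¹`. -/
def toInv (W : Word A) (i : W.dom) : W.inv.dom := OrderDual.toDual i

theorem trunc_inv (N : ℕ) (W : Word A) :
    trunc N W.inv = ((trunc N W).map Letter.inv).reverse := by
  obtain ⟨l, s, m, e⟩ := exists_trunc N W
  have h := trunc_eq N W.inv (l.map (toInv W)).reverse ?_ ?_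
  · rw [h, e, List.map_reverse, List.map_map, List.map_map]
    rfl
  · rw [List.sortedLT_iff_pairwise] at s ⊢
    rw [List.pairwise_reverse, List.pairwise_map]
    exact s.imp fun hab => OrderDual.toDual_lt_toDual.2 hab
  · intro i
    rw [List.mem_reverse, List.mem_map]
    constructor
    · rintro ⟨j, hj, rfl⟩
      exact (m j).1 hj
    · intro hi
      exact ⟨OrderDual.ofDual i, (m _).2 hi, rfl⟩

theorem trunc_congr {W₀ W₁ : Word A} (h : Equivalent W₀ W₁) (N : ℕ) :
    trunc N W₀ = trunc N W₁ := by
  obtain ⟨f, hf⟩ := h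
  obtain ⟨l, s, m, e⟩ := exists_trunc N W₀
  rw [trunc_eq N W₁ (l.map f), e, List.map_map]
  · exact List.map_congr_left fun i _ => (hf i).symm
  · rw [List.sortedLT_iff_pairwise] at s ⊢
    rw [List.pairwise_map]
    exact s.imp fun hab => f.lt_iff_lt.2 hab
  · intro i
    obtain ⟨j, rfl⟩ := f.surjective i
    simp [hf, m]

theorem eval_empty (N : ℕ) : eval N (empty : Word A) = 1 := by
  rw [eval, trunc_empty]; rfl

theorem eval_concat (N : ℕ) (W₀ W₁ : Word A) :
    eval N (concat W₀ W₁) = eval N W₀ * eval N W₁ := by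
  rw [eval, trunc_concat, eval, eval, FreeGroup.mul_mk]

theorem eval_inv (N : ℕ) (W : Word A) : eval N W.inv = (eval N W)⁻¹ := by
  rw [eval, trunc_inv, eval, FreeGroup.inv_mk]; rfl

/-- `W₀ ∼ W₁`: for every `N` the finite words `p_N(W₀)` and `p_N(W₁)` are equal in the free group
on the positive letters.  The relation `≡` is finer, by `Word.Equivalent.sim`. -/
instance sim (A : Type u) : Setoid (Word A) where
  r W₀ W₁ := ∀ N : ℕ, eval N W₀ = eval N W₁
  iseqv := ⟨fun _ _ => rfl, fun h N => (h N).symm, fun h h' N => (h N).trans (h' N)⟩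

theorem Equivalent.sim {W₀ W₁ : Word A} (h : Equivalent W₀ W₁) : W₀ ≈ W₁ := fun N => by
  rw [eval, eval, trunc_congr h]

/-- A word is `α`-pure if all its letters have first subscript `α`. -/
def IsPureAt (α : A) (W : Word A) : Prop := ∀ i, (W.letter i).proj₀ = α

/-- A word is pure if it is `α`-pure for some `α`. -/
def IsPure (W : Word A) : Prop := ∃ α, IsPureAt α W

end Word

/-- The set of words modulo `∼`.  Since `≡` is finer than `∼`, this is also the quotient by `∼` of
the set of `≡`-classes. -/
def WordGroup (A : Type u) : Type (max u 1) := Quotient (Word.sim A)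

namespace WordGroup

variable {A : Type u}

/-- The class `[W]` of a word. -/
def mk (W : Word A) : WordGroup A := Quotient.mk (Word.sim A) W

/-- The group structure with `[W₀][W₁] = [W₀W₁]`, `[W]⁻¹ = [W⁻¹]` and identity `[E]`. -/
instance : Group (WordGroup A) where
  mul := Quotient.map₂ Word.concat fun _ _ h _ _ h' N => by
    rw [Word.eval_concat, Word.eval_concat, h N, h' N]
  one := mk Word.empty
  inv := Quotient.map Word.inv fun _ _ h N => by rw [Word.eval_inv, Word.eval_inv, h N]
  mul_assoc a b c := by
    induction a using Quotient.ind
    induction b using Quotient.ind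
    induction c using Quotient.ind
    exact Quotient.sound fun N => by simp only [Word.eval_concat, mul_assoc]
  one_mul a := by
    induction a using Quotient.ind
    exact Quotient.sound fun N => by rw [Word.eval_concat, Word.eval_empty, one_mul]
  mul_one a := by
    induction a using Quotient.ind
    exact Quotient.sound fun N => by rw [Word.eval_concat, Word.eval_empty, mul_one]
  inv_mul_cancel a := by
    induction a using Quotient.ind
    exact Quotient.sound fun N => by
      rw [Word.eval_concat, Word.eval_inv, Word.eval_empty, inv_mul_cancel]

/-- The smallest normal subgroup that contains the classes of all pure words. -/
def pureSubgroup (A : Type u) : Subgroup (WordGroup A) :=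
  Subgroup.normalClosure (mk '' {W : Word A | W.IsPure})

instance (A : Type u) : (pureSubgroup A).Normal :=
  Subgroup.normalClosure_normal

end WordGroup

/-- The cone group `C_κ`, whose letters are `a_{α,n}^{±1}` for ordinals `α < κ` and `n : ℕ`. -/
abbrev ConeGroup (κ : Cardinal.{u}) : Type (max u 1) :=
  WordGroup κ.ord.ToType ⧸ WordGroup.pureSubgroup κ.ord.ToType

/-! Truncations embed the word group in a countable power of a free group, which gives the upper
bound `κ ^ ℵ₀` once `κ ≥ 2`; for `κ = 1` every word is pure and the quotient is trivial. For the
lower bound, map the letters to homeomorphisms of the line that commute with integer translations,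
so that all letters with the same first subscript fix a common point. A pure word then evaluates,
truncation by truncation, to maps moving points by at most 1. Sequences of uniformly bounded
displacement form a normal subgroup, so every element of the pure subgroup has bounded displacement.
Yet two maps, each with a fixed point, can have a product that moves some point up by at least 1,
and the powers of this product have unbounded displacement. For each sequence `f`, the word
`interleave o f` alternates letters of subscript `o` with letters of subscript `f i`. If `f m ≠ g
m`, a map that sees only the places of `m` makes one of the two words unbounded and the other
bounded, so their classes differ (`interleave_inv_mul_notMem`). -/

/-! ### Degree one lifts and bounded displacement. -/

namespace CircleDeg1Lift

/-- The degree one lift that fixes every integer and acts on `[0, 1)` by `h`. -/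
noncomputable def ofFract (h : ℝ → ℝ) (hm : Monotone h)
    (hI : ∀ s ∈ Set.Ico (0 : ℝ) 1, h s ∈ Set.Ico (0 : ℝ) 1) : CircleDeg1Lift where
  toFun t := ⌊t⌋ + h (Int.fract t)
  monotone' t u htu := by
    have ht := hI _ ⟨Int.fract_nonneg t, Int.fract_lt_one t⟩
    have hu := hI _ ⟨Int.fract_nonneg u, Int.fract_lt_one u⟩
    rcases (Int.floor_mono htu).eq_or_lt with e | e
    · have : h (Int.fract t) ≤ h (Int.fract u) := hm (by
        rw [Int.fract, Int.fract, e]; linarith)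
      simpa only [e] using! add_le_add_right this _
    · have : (⌊t⌋ : ℝ) + 1 ≤ ⌊u⌋ := by exact_mod_cast e
      change (⌊t⌋ : ℝ) + h (Int.fract t) ≤ ⌊u⌋ + h (Int.fract u)
      linarith [ht.2, hu.1]
  map_add_one' t := by
    simp only [Int.floor_add_one, Int.fract_add_one]
    push_cast
    ring

theorem ofFract_apply {h : ℝ → ℝ} (hm : Monotone h)
    (hI : ∀ s ∈ Set.Ico (0 : ℝ) 1, h s ∈ Set.Ico (0 : ℝ) 1) (n : ℤ) {s : ℝ}
    (hs : s ∈ Set.Ico (0 : ℝ) 1) : ofFract h hm hI (n + s) = n + h s := by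
  have hf : ⌊(n : ℝ) + s⌋ = n := by
    rw [Int.floor_eq_iff]; exact ⟨by linarith [hs.1], by linarith [hs.2]⟩
  change (⌊(n : ℝ) + s⌋ : ℝ) + h (Int.fract (n + s)) = n + h s
  rw [Int.fract, hf, add_sub_cancel_left]

theorem ofFract_comp {h k : ℝ → ℝ} (hm : Monotone h)
    (hI : ∀ s ∈ Set.Ico (0 : ℝ) 1, h s ∈ Set.Ico (0 : ℝ) 1) (km : Monotone k)
    (kI : ∀ s ∈ Set.Ico (0 : ℝ) 1, k s ∈ Set.Ico (0 : ℝ) 1) (hk : ∀ s, h (k s) = s) :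
    ofFract h hm hI * ofFract k km kI = 1 := by
  ext t
  have ht : Int.fract t ∈ Set.Ico (0 : ℝ) 1 := ⟨Int.fract_nonneg t, Int.fract_lt_one t⟩
  rw [mul_apply, ← Int.floor_add_fract t, ofFract_apply km kI _ ht,
    ofFract_apply hm hI _ (kI _ ht), hk]
  rfl

/-- A homeomorphism of the line that fixes every integer and pushes all other points upwards. -/
noncomputable def push : CircleDeg1Liftˣ where
  val := ofFract (fun s => min (4 * s) ((s + 3) / 4))
    (fun a b hab => min_le_min (by linarith) (by linarith))
    (fun s hs => ⟨le_min (by linarith [hs.1]) (by linarith [hs.1]),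
      (min_le_right _ _).trans_lt (by linarith [hs.2])⟩)
  inv := ofFract (fun s => max (s / 4) (4 * s - 3))
    (fun a b hab => max_le_max (by linarith) (by linarith))
    (fun s hs => ⟨le_max_of_le_left (by linarith [hs.1]),
      max_lt (by linarith [hs.2]) (by linarith [hs.2])⟩)
  -- The inverse of a minimum of increasing bijections is the maximum of their inverses.
  val_inv := ofFract_comp _ _ _ _ fun s => by
    rcases le_total (s / 4) (4 * s - 3) with h | h
    · rw [max_eq_right h, min_eq_right] <;> linarith
    · rw [max_eq_left h, min_eq_left] <;> linarith
  inv_val := ofFract_comp _ _ _ _ fun s => by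
    rcases le_total (4 * s) ((s + 3) / 4) with h | h
    · rw [min_eq_left h, max_eq_left] <;> linarith
    · rw [min_eq_right h, max_eq_right] <;> linarith

theorem push_apply (n : ℤ) {s : ℝ} (hs : s ∈ Set.Ico (0 : ℝ) 1) :
    push (n + s) = n + min (4 * s) ((s + 3) / 4) :=
  ofFract_apply _ _ n hs

/-- The conjugate of `push` by the translation by `1 / 2`. -/
noncomputable def pushHalf : CircleDeg1Liftˣ :=
  translate (Multiplicative.ofAdd (1 / 2)) * push * (translate (Multiplicative.ofAdd (1 / 2)))⁻¹

theorem pushHalf_apply (t : ℝ) : pushHalf t = 1 / 2 + push (-(1 / 2) + t) := rfl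

theorem push_zero : push 0 = 0 := by
  have h := push_apply 0 (s := 0) (by norm_num)
  norm_num at h
  exact h

theorem pushHalf_half : pushHalf (1 / 2) = 1 / 2 := by
  rw [pushHalf_apply, neg_add_cancel, push_zero, add_zero]

/-- `pushHalf` carries 4/5 past the barrier 1 of `push`, to 53/40; `push` then carries it past the
barrier 3/2 of `pushHalf`, to more than 9/5. -/
theorem le_push_mul_pushHalf :
    (4 / 5 : ℝ) + (1 : ℤ) ≤ (push * pushHalf : CircleDeg1Liftˣ) (4 / 5) := by
  have h₁ := push_apply 0 (s := 3 / 10) (by norm_num)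
  have h₂ := push_apply 1 (s := 13 / 40) (by norm_num)
  norm_num at h₁ h₂
  rw [Units.val_mul, mul_apply, pushHalf_apply]
  norm_num [h₁, h₂]

/-- The stabilizer of a point. -/
def fixing (p : ℝ) : Subgroup CircleDeg1Liftˣ where
  carrier := {u | u p = p}
  mul_mem' {u v} hu hv := by
    change (u : CircleDeg1Lift) ((v : CircleDeg1Lift) p) = p
    rw [hv, hu]
  one_mem' := rfl
  inv_mem' {u} hu := by
    change (u⁻¹ : CircleDeg1Liftˣ) p = p
    nth_rw 1 [← show u p = p from hu]
    exact units_inv_apply_apply u p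

/-- All integer translates of `p` are fixed too, and one of them lies in `[t, t + 1)`; by
monotonicity `t` cannot jump over it. -/
theorem apply_le_of_mem_fixing {p : ℝ} {u : CircleDeg1Liftˣ} (hu : u ∈ fixing p) (t : ℝ) :
    u t ≤ t + 1 := by
  have h : t ≤ p + ⌈t - p⌉ := by linarith [Int.le_ceil (t - p)]
  calc u t ≤ u (p + ⌈t - p⌉) := mono _ h
    _ = p + ⌈t - p⌉ := by rw [map_add_int, show u p = p from hu]
    _ ≤ t + 1 := by linarith [Int.ceil_lt_add_one (t - p)]

/-- The sequences of homeomorphisms that move the points of the line by a uniformly bounded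
amount. -/
def boundedDisplacement : Subgroup (ℕ → CircleDeg1Liftˣ) where
  carrier := {u | ∃ K : ℕ, ∀ N t, u N t ≤ t + K ∧ (u N)⁻¹ t ≤ t + K}
  mul_mem' {u v} := by
    rintro ⟨K, hK⟩ ⟨M, hM⟩
    refine ⟨K + M, fun N t => ⟨?_, ?_⟩⟩
    · change (u N : CircleDeg1Lift) ((v N : CircleDeg1Lift) t) ≤ _
      push_cast
      linarith [(hK N (v N t)).1, (hM N t).1]
    · rw [Pi.mul_apply, mul_inv_rev]
      change (v N)⁻¹ ((u N)⁻¹ t) ≤ _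
      push_cast
      linarith [(hM N ((u N)⁻¹ t)).2, (hK N t).2]
  one_mem' := ⟨0, fun N t => by simp⟩
  inv_mem' {u} := by
    rintro ⟨K, hK⟩
    exact ⟨K, fun N t => ⟨(hK N t).2, by simpa using (hK N t).1⟩⟩

/-- This is why `K` is an integer: `v` commutes with integer translations, so conjugation keeps the
same bound. -/
theorem conj_apply_le {u v : CircleDeg1Liftˣ} {K : ℕ} (h : ∀ t, u t ≤ t + K) (t : ℝ) :
    (v * u * v⁻¹ : CircleDeg1Liftˣ) t ≤ t + K :=
  calc (v * u * v⁻¹ : CircleDeg1Liftˣ) t = v (u (v⁻¹ t)) := rfl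
    _ ≤ v (v⁻¹ t + K) := mono _ (h _)
    _ = t + K := by rw [map_add_nat, units_apply_inv_apply]

instance : boundedDisplacement.Normal where
  conj_mem := by
    rintro u ⟨K, hK⟩ v
    refine ⟨K, fun N t => ⟨conj_apply_le (fun t => (hK N t).1) t, ?_⟩⟩
    have h : ((v * u * v⁻¹) N)⁻¹ = v N * (u N)⁻¹ * (v N)⁻¹ := by
      simp [mul_assoc]
    rw [h]
    exact conj_apply_le (fun t => (hK N t).2) t

theorem mem_boundedDisplacement_of_fixing {p : ℝ} {u : ℕ → CircleDeg1Liftˣ}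
    (hu : ∀ N, u N ∈ fixing p) : u ∈ boundedDisplacement :=
  ⟨1, fun N t => by
    rw [Nat.cast_one]
    exact ⟨apply_le_of_mem_fixing (hu N) t, apply_le_of_mem_fixing (inv_mem (hu N)) t⟩⟩

theorem notMem_boundedDisplacement {u : ℕ → CircleDeg1Liftˣ}
    (hu : ∀ n : ℕ, ∃ N, u N = (push * pushHalf) ^ (n + 1)) : u ∉ boundedDisplacement := by
  rintro ⟨K, hK⟩
  obtain ⟨N, hN⟩ := hu K
  have h := (hK N (4 / 5)).1
  -- The power `K + 1` moves 4/5 up by at least `K + 1`, against the bound `K`.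
  have h' := le_iterate_of_add_int_le_map _ le_push_mul_pushHalf (K + 1)
  rw [hN, Units.val_pow_eq_pow_val, coe_pow] at h
  push_cast at h h'
  linarith

end CircleDeg1Lift

/-! ### Evaluating words in a group through their truncations. -/

namespace WordGroup

variable {A : Type u}

/-- The truncations `p_N` as a homomorphism to a power of the free group. -/
noncomputable def evalHom (A : Type u) : WordGroup A →* (ℕ → FreeGroup (A × ℕ)) where
  toFun := Quotient.lift (fun W N => Word.eval N W) fun _ _ h => funext h
  map_one' := funext fun N => Word.eval_empty N
  map_mul' a b := by
    induction a using Quotient.ind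
    induction b using Quotient.ind
    exact funext fun N => Word.eval_concat N _ _

theorem evalHom_injective : Function.Injective (evalHom A) := by
  intro a b h
  induction a using Quotient.ind
  induction b using Quotient.ind
  exact Quotient.sound fun N => congrFun h N

theorem lift_eval_mem_of_isPureAt {G : Type*} [Group G] (ψ : A × ℕ → G) {a : A} {W : Word A}
    (hW : W.IsPureAt a) {H : Subgroup G} (hψ : ∀ n, ψ (a, n) ∈ H) (N : ℕ) :
    FreeGroup.lift ψ (Word.eval N W) ∈ H := by
  obtain ⟨l, -, -, hl⟩ := Word.exists_trunc N W
  rw [Word.eval, hl, FreeGroup.lift_mk]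
  refine Subgroup.list_prod_mem _ fun x hx => ?_
  simp only [List.map_map, List.mem_map, Function.comp_apply] at hx
  obtain ⟨i, -, rfl⟩ := hx
  have hi : ψ (W.letter i).1 ∈ H := by
    have h : (W.letter i).1 = (a, (W.letter i).1.2) := Prod.ext (hW i) rfl
    rw [h]
    exact hψ _
  cases (W.letter i).2
  · exact inv_mem hi
  · exact hi

/-- The homomorphism that applies `FreeGroup.lift ψ` to all truncations. -/
noncomputable def liftHom {G : Type*} [Group G] (ψ : A × ℕ → G) : WordGroup A →* (ℕ → G) :=
  (MonoidHom.pi fun N => (FreeGroup.lift ψ).comp (Pi.evalMonoidHom _ N)).comp (evalHom A)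

open CircleDeg1Lift in
theorem liftHom_mem_boundedDisplacement {ψ : A × ℕ → CircleDeg1Liftˣ}
    (hψ : ∀ a, ∃ p, ∀ n, ψ (a, n) ∈ fixing p) {w : WordGroup A} (hw : w ∈ pureSubgroup A) :
    liftHom ψ w ∈ boundedDisplacement := by
  have h : pureSubgroup A ≤ boundedDisplacement.comap (liftHom ψ) := by
    refine Subgroup.normalClosure_le_normal ?_
    rintro _ ⟨W, ⟨a, ha⟩, rfl⟩
    obtain ⟨p, hp⟩ := hψ a
    exact mem_boundedDisplacement_of_fixing fun N => lift_eval_mem_of_isPureAt ψ ha hp N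
  exact h hw

/-! ### The family of words and its separation. -/

/-- The letters of `interleave`. -/
def interleaveLetter (o : A) (f : ℕ → A) (k : ℕ) : Letter A :=
  ((if k % 2 = 0 then f (k / 2).unpair.1 else o, k), true)

/-- The word of order type `ω` whose letters have the second subscripts `0, 1, 2, …`.  Its letters
at odd places have the first subscript `o`, and those at even places have the first subscripts
`f i`, each of them infinitely often. -/
def interleave (o : A) (f : ℕ → A) : Word A where
  dom := ℕ
  letter := interleaveLetter o f
  finite_le N := Set.finite_Iic N

theorem trunc_interleave (o : A) (f : ℕ → A) (N : ℕ) :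
    Word.trunc N (interleave o f) = (List.range (N + 1)).map (interleaveLetter o f) :=
  Word.trunc_eq N (interleave o f) (List.range (N + 1)) (List.sortedLT_range _) fun _ =>
    List.mem_range.trans Nat.lt_succ_iff

open Classical in
/-- The map on letters that sends `a_{a,n}` to `x` and `a_{o,n}` to `y` if `n` is one of the places
of `interleave o f` that belong to the value `f m`, and all other letters to `1`. -/
noncomputable def detect {G : Type*} [Group G] (x y : G) (a o : A) (m : ℕ) (l : A × ℕ) : G :=
  if (l.2 / 2).unpair.1 = m then if l.1 = a then x else if l.1 = o then y else 1 else 1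

/-- The letters at `2 * j` and `2 * j + 1` form a block, which contributes one factor if `j.unpair.1
= m` and nothing otherwise. Truncating at an odd number leaves `M + 1` whole blocks. The subscript
`2 * Nat.pair m 0` merely represents the places of `m`. -/
theorem lift_detect_interleave {G : Type*} [Group G] (x y : G) {a o : A} (hao : a ≠ o) (m : ℕ)
    (f : ℕ → A) (M : ℕ) :
    FreeGroup.lift (detect x y a o m) (Word.eval (2 * M + 1) (interleave o f)) =
      (detect x y a o m (f m, 2 * Nat.pair m 0) * y) ^
        Nat.count (fun j => j.unpair.1 = m) (M + 1) := by
  have key : ∀ M : ℕ, FreeGroup.lift (detect x y a o m)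
      (FreeGroup.mk ((List.range (2 * M)).map (interleaveLetter o f))) =
      (detect x y a o m (f m, 2 * Nat.pair m 0) * y) ^
        Nat.count (fun j => j.unpair.1 = m) M := by
    intro M
    induction M with
    | zero => simp
    | succ M ih =>
      rw [Nat.mul_succ, List.range_succ, List.range_succ, List.map_append, List.map_append,
        ← FreeGroup.mul_mk, ← FreeGroup.mul_mk, map_mul, map_mul, ih, Nat.count_succ, mul_assoc]
      have h₁ : (2 * M + 1) % 2 = 1 := by omega
      have h₂ : (2 * M + 1) / 2 = M := by omega
      by_cases hM : M.unpair.1 = m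
      · simp [interleaveLetter, detect, hM, h₁, h₂, hao.symm, pow_succ]
        split_ifs <;> rfl
      · simp [interleaveLetter, detect, hM, h₂]
  rw [Word.eval, trunc_interleave]
  exact key (M + 1)

open CircleDeg1Lift in
theorem interleave_inv_mul_notMem {o : A} {f g : ℕ → A} {m : ℕ} (ho : f m ≠ o) (h : g m ≠ f m) :
    (mk (interleave o g))⁻¹ * mk (interleave o f) ∉ pureSubgroup A := by
  intro hw
  let ψ := detect push pushHalf (f m) o m
  have hψ : ∀ a, ∃ p, ∀ n, ψ (a, n) ∈ fixing p := by
    intro a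
    by_cases ha : a = f m
    · refine ⟨0, fun n => ?_⟩
      simp only [ψ, detect, ha, if_true]
      split_ifs
      exacts [push_zero, one_mem _]
    · refine ⟨1 / 2, fun n => ?_⟩
      simp only [ψ, detect, ha, if_false]
      split_ifs
      exacts [pushHalf_half, one_mem _, one_mem _]
  have hb := liftHom_mem_boundedDisplacement hψ hw
  -- Only truncations made of whole blocks are kept; a subsequence inherits the bound.
  let odd : (ℕ → CircleDeg1Liftˣ) →* (ℕ → CircleDeg1Liftˣ) :=
    MonoidHom.pi fun M => Pi.evalMonoidHom _ (2 * M + 1)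
  have hb' : odd (liftHom ψ ((mk (interleave o g))⁻¹ * mk (interleave o f))) ∈
      boundedDisplacement := by
    obtain ⟨K, hK⟩ := hb
    exact ⟨K, fun N => hK _⟩
  -- Since `g m ≠ f m`, no `push` occurs: each block gives `pushHalf` or its square, which fix 1/2.
  have hg : odd (liftHom ψ (mk (interleave o g))) ∈ boundedDisplacement := by
    refine mem_boundedDisplacement_of_fixing (p := 1 / 2) fun M => ?_
    change FreeGroup.lift ψ (Word.eval (2 * M + 1) (interleave o g)) ∈ _
    rw [lift_detect_interleave _ _ ho]
    refine pow_mem (mul_mem ?_ pushHalf_half) _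
    simp only [detect, h, if_false]
    split_ifs
    exacts [pushHalf_half, one_mem _, one_mem _]
  have hf := mul_mem hg hb'
  rw [map_mul, map_mul, map_inv, map_inv, mul_inv_cancel_left] at hf
  refine notMem_boundedDisplacement (fun n => ?_) hf
  -- The value `f m` recurs infinitely often, so every exponent is attained.
  have hinf : (Set.ofPred fun j : ℕ => j.unpair.1 = m).Infinite :=
    Set.infinite_of_injective_forall_mem (f := fun i => Nat.pair m i)
      (fun i j hij => (Nat.pair_eq_pair.1 hij).2) fun i =>
        congrArg Prod.fst (Nat.unpair_pair m i)
  obtain ⟨M, hM⟩ := Nat.surjective_count_of_infinite_setOfPred hinf (n + 1)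
  obtain ⟨M, rfl⟩ := Nat.exists_eq_succ_of_ne_zero (n := M) (by rintro rfl; simp at hM)
  refine ⟨M, ?_⟩
  change FreeGroup.lift ψ (Word.eval (2 * M + 1) (interleave o f)) = _
  rw [lift_detect_interleave _ _ ho, ← hM]
  simp [detect]

/-- Distinct sequences yield distinct elements of the cone group. -/
theorem mk_interleave_injective (o : A) : Function.Injective fun f : ℕ → A =>
    (QuotientGroup.mk (mk (interleave o f)) : WordGroup A ⧸ pureSubgroup A) := by
  intro f g hfg
  by_contra hne
  obtain ⟨m, hm⟩ := Function.ne_iff.1 hne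
  -- The detected value must differ from `o`; at least one of `f m`, `g m` does.
  by_cases ho : f m = o
  · exact interleave_inv_mul_notMem (f := g) (g := f) (fun hg => hm (ho.trans hg.symm)) hm
      (QuotientGroup.eq.1 hfg)
  · exact interleave_inv_mul_notMem ho (Ne.symm hm) (QuotientGroup.eq.1 hfg.symm)

/-! ### Cardinalities. -/

open Cardinal in
theorem lift_mk_le (A : Type u) [Nontrivial A] : #(WordGroup A) ≤ lift.{1} (#A ^ ℵ₀) := by
  have h := lift_mk_le_lift_mk_of_injective (evalHom_injective (A := A))
  have hA : 2 ≤ #A := two_le_iff.2 (exists_pair_ne A)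
  have h₁ : #A ≤ #A ^ (ℵ₀ : Cardinal.{u}) := self_le_power _ one_le_aleph0
  -- This fails for a one-element `A`, whence `Nontrivial A`.
  have h₂ : ℵ₀ ≤ #A ^ (ℵ₀ : Cardinal.{u}) :=
    (cantor ℵ₀).le.trans (power_le_power_right hA)
  have h₃ : #(FreeGroup (A × ℕ)) ≤ #A ^ (ℵ₀ : Cardinal.{u}) := by
    rw [mk_freeGroup, mk_prod, lift_uzero, mk_nat, lift_aleph0]
    exact max_le (mul_le_of_le h₂ h₁ h₂) h₂
  have h₄ : #(ℕ → FreeGroup (A × ℕ)) ≤ #A ^ (ℵ₀ : Cardinal.{u}) := by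
    rw [mk_arrow, lift_uzero, mk_nat, lift_aleph0]
    refine (power_le_power_right h₃).trans_eq ?_
    rw [← power_mul, aleph0_mul_aleph0]
  rw [← lift_le.{u}, lift_lift]
  exact h.trans (lift_le.2 h₄)

theorem pureSubgroup_eq_top [Subsingleton A] [Nonempty A] : pureSubgroup A = ⊤ := by
  refine eq_top_iff.2 fun w _ => ?_
  induction w using Quotient.ind with
  | _ W =>
    obtain ⟨a⟩ := ‹Nonempty A›
    exact Subgroup.subset_normalClosure ⟨W, ⟨a, fun i => Subsingleton.elim _ _⟩, rfl⟩

theorem subsingleton_of_isEmpty [IsEmpty A] : Subsingleton (WordGroup A) :=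
  evalHom_injective.subsingleton

end WordGroup

open Cardinal in
theorem mainTheorem6 (κ : Cardinal.{u}) :
    (κ = 0 → Cardinal.mk (ConeGroup κ) = 1) ∧
      (1 ≤ κ → Cardinal.mk (ConeGroup κ) = Cardinal.lift.{1} (κ ^ Cardinal.aleph0.{u})) := by
  have hκ : #κ.ord.ToType = κ := mk_ord_toType κ
  constructor
  · rintro h
    have : IsEmpty κ.ord.ToType := mk_eq_zero_iff.1 (hκ.trans h)
    have := WordGroup.subsingleton_of_isEmpty (A := κ.ord.ToType)
    have : Subsingleton (ConeGroup κ) := QuotientGroup.mk_surjective.subsingleton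
    exact mk_eq_one _
  · intro h
    have hne : Nonempty κ.ord.ToType := by
      rw [← mk_ne_zero_iff, hκ]
      exact (zero_lt_one.trans_le h).ne'
    obtain ⟨o⟩ := hne
    apply le_antisymm
    -- For `κ = 1` the word group itself is too large, so the bound must come from the quotient.
    · rcases subsingleton_or_nontrivial κ.ord.ToType with hs | hn
      · have : Subsingleton (ConeGroup κ) := by
          have : Nonempty κ.ord.ToType := ⟨o⟩
          rw [ConeGroup, WordGroup.pureSubgroup_eq_top]
          exact QuotientGroup.subsingleton_quotient_top
        rw [mk_eq_one (ConeGroup κ), one_le_lift_iff]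
        exact (one_power (a := ℵ₀)).ge.trans (power_le_power_right h)
      · exact (mk_le_of_surjective QuotientGroup.mk_surjective).trans
          ((WordGroup.lift_mk_le _).trans_eq (by rw [hκ]))
    · have h := lift_mk_le_lift_mk_of_injective (WordGroup.mk_interleave_injective o)
      rw [mk_arrow, hκ, lift_uzero, mk_nat, lift_aleph0, lift_id'.{u, max 1 u}] at h
      exact (congrFun lift_umax.{u, 1} _).ge.trans h
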